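/- **Setting.** A projective link diagram $L$ is drawn as a tangle diagram in a disk with $2k$ boundary points that are identified antipodally. The virtual link diagram $\pi(L)$ consists of the same tangle and of arcs outside the disk that join antipodal boundary points; mutual crossings of these arcs are virtual, and virtual diagrams are regarded as Gauss codes. A state is a choice of the $A$- or $B$-smoothing at each (classical) crossing; a state of $L$ and the same state of $\pi(L)$ have corresponding state circles. Let $V=\mathbb{Q}1\oplus\mathbb{Q}X$ with $m(1\otimes 1)=1$, $m(1\otimes X)=m(X\otimes 1)=X$, $m(X\otimes X)=0$, $\Delta(1)=1\otimes X+X\otimes 1$, $\Delta(X)=X\otimes X$, and let barring be the map $\overline{a1+bX}=a1-bX$. In both theories the cochain group $C^i$ is the direct sum, over the states with $i$ $B$-smoothings, of $V^{\otimes\{\text{state circles}\}}$, with the basis of states whose circles are labelled by $1$ or $X$, and the differential is the sum of edge maps changing one $A$-smoothing to a $B$-smoothing: $m$ if two circles become one, $\Delta$ if one becomes two, $0$ if one becomes one. Fix at each crossing local orientations of the two strands. Turned so that both strands go up, the crossing carries the locally consistent (source-sink) orientation in which the south-west and north-east half-edges point in and the other two point out; it orients the arcs of both smoothings. Fix a numbering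 of the circles of every state. In both theories an edge map carries the *permutation sign*: the product of the signs of the permutation that promotes the circles at the site to the first positions (the arc at the south-west end first, the one at the north-east end second), and of the one from the new circles followed by the untouched circles in the old order to the new numbering. The remaining signs are as follows. *Manolescu–Willis complex $C_{MW}(L)$, unlabeled* (the same $V$ is used for circles of class $0$ and of class $1$, i.e. $\overline X$ is replaced by $X$). Choose an orientation of every circle of every state. Nearby consistency: the algebra element of a circle at the site, before and after the bifurcation, is barred if the orientation of the circle differs from the locally consistent one. Far orientations: the result is multiplied by $-1$ for every circle away from the site that carries $X$ and has different orientations before and after. *Dye–Kaestner–Kauffman complex $C_{DKK}(\pi(L))$.* Choose an orientation of the virtual link $\pi(L)$, and put a cut point on each half-edge at a crossing where the source-sink orientation differs from the orientation of the link. Choose a base point on every circle of every state; the local orientation there orients the circle. Algebra elements are transported, along the orientation of the circles, from the base points to the site before the bifurcation, from the site to the new base points afterwards, and from the old to the new base point on the other circles; they are barred once for every cut point passed. **Theorem.** Let $L$ be a projective link diagram, and choose an orientation of $\pi(L)$, local orientations at the crossings, and numberings of and base points on the state circles of $\pi(L)$. There are corresponding Manolescu–Willis choices for $L$: the same local orientations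 and numberings, and each circle of each state oriented by the local orientation at its base point. For these choices, the linear maps $$\alpha\colon C^i_{MW}(L)\to C^i_{DKK}(\pi(L)),\qquad [s]\mapsto[\pi(s)],$$ where $\pi(s)$ is the labelled state of $\pi(L)$ that corresponds to the labelled state $s$ of $L$, are bijective and commute with the differentials, and $\alpha$ induces isomorphisms $H^i_{MW}(L)\cong H^i_{DKK}(\pi(L))$ for all $i$. -/

import Mathlib

/-! ## Link codes: abstract diagrams, virtual link diagrams -/

/-- The code of a link diagram on some surface.  At every crossing the four half-edges are numbered
`0, 1, 2, 3` counterclockwise, and `0, 2` are the two ends of the under-strand.  `Aux` is the set of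
ends of two-valent vertices, which are points on a strand that is simply continued there: `pass`
exchanges the two ends at such a vertex.  `arc` matches the two ends of every edge.  Two-valent
vertices allow to encode components without crossings, and to place base points in the interior
of an edge between two crossings. -/
structure LinkCode where
  Crossing : Type
  Aux : Type
  [fintypeCrossing : Fintype Crossing]
  [decidableEqCrossing : DecidableEq Crossing]
  [finiteAux : Finite Aux]
  arc : (Crossing × Fin 4) ⊕ Aux → (Crossing × Fin 4) ⊕ Aux
  arc_arc : ∀ x, arc (arc x) = x
  arc_ne : ∀ x, arc x ≠ x
  pass : Aux → Aux
  pass_pass : ∀ q, pass (pass q) = q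
  pass_ne : ∀ q, pass q ≠ q

attribute [instance] LinkCode.fintypeCrossing LinkCode.decidableEqCrossing LinkCode.finiteAux

/-- A virtual link diagram, given as a Gauss code (no planarity is required): only the classical
crossings are recorded, the virtual crossings are those forced by drawing the code in the plane. -/
abbrev VirtualLinkDiagram : Type 1 := LinkCode

/-- The partner of a half-edge under the `A`-smoothing (`false`, arcs `01` and `23`) or the
`B`-smoothing (`true`, arcs `03` and `12`) of a crossing. -/
def smoothing : Bool → Fin 4 → Fin 4
  | false => ![1, 0, 3, 2]
  | true => ![3, 2, 1, 0]

namespace LinkCode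

variable (N : LinkCode)

/-- The points of a code: ends of edges at crossings and at two-valent vertices. -/
abbrev Point : Type := (N.Crossing × Fin 4) ⊕ N.Aux

/-- A Kauffman state: `false` is the `A`-smoothing, `true` the `B`-smoothing. -/
abbrev KState : Type := N.Crossing → Bool

variable {N}

/-- How a strand continues through the vertex at a point, after smoothing. -/
def joint (s : N.KState) : N.Point → N.Point
  | Sum.inl (c, i) => Sum.inl (c, smoothing (s c) i)
  | Sum.inr q => Sum.inr (N.pass q)

/-- The state circles of a Kauffman state. -/
def Circle (s : N.KState) : Type :=
  Quot (fun x y : N.Point => y = N.arc x ∨ y = joint s x)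

/-- The state circle through a point. -/
def circleAt (s : N.KState) (x : N.Point) : Circle s := Quot.mk _ x

instance (s : N.KState) : Finite (Circle s) := by
  unfold Circle; infer_instance

noncomputable instance (s : N.KState) : Fintype (Circle s) := Fintype.ofFinite _

/-- The circle of the state `t` that has a point in common with the given circle of `s`; for a
circle that does not meet the crossings where `s` and `t` differ, this is the same curve. -/
noncomputable def carry {s : N.KState} (t : N.KState) (a : Circle s) : Circle t :=
  circleAt t (Quot.out a)

/-- The number of `B`-smoothings of a state. -/
def height (s : N.KState) : ℕ := (Finset.univ.filter fun c => s c = true).card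

variable (N) in
/-- The standard basis of the cochain group in degree `i`: states of height `i` with
a basis vector `1` (`false`) or `X` (`true`) on every state circle. -/
abbrev Enhanced (i : ℕ) : Type :=
  {e : Σ s : N.KState, (Circle s → Bool) // height e.1 = i}

variable (N) in
/-- The cochain group in degree `i`, that is, the direct sum of the spaces `V ⊗ ⋯ ⊗ V` (one factor
for each state circle, `V = ℚ 1 ⊕ ℚ X`) over the states of height `i`. -/
abbrev Cochain (i : ℕ) : Type := N.Enhanced i →₀ ℚ

end LinkCode

/-! ## Projective link diagrams and the associated virtual link diagram -/

/-- The antipode of a point among `2 k` points on a circle. -/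
def antipode {k : ℕ} (i : Fin (2 * k)) : Fin (2 * k) :=
  ⟨if i.1 < k then i.1 + k else i.1 - k, by split <;> omega⟩

theorem antipode_antipode {k : ℕ} (i : Fin (2 * k)) : antipode (antipode i) = i := by
  have := i.2
  ext
  simp only [antipode]
  split_ifs <;> omega

theorem antipode_ne {k : ℕ} (i : Fin (2 * k)) : antipode i ≠ i := by
  have := i.2
  intro h
  have h2 := congrArg Fin.val h
  simp only [antipode] at h2
  split_ifs at h2 <;> omega

/-- The number of cycles (fixed points included) of a permutation. -/
noncomputable def cycleCount {α : Type} (f : Equiv.Perm α) : ℕ :=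
  Nat.card (Quotient (Equiv.Perm.SameCycle.setoid f))

/-- The counterclockwise rotation around the vertices of a disk diagram, whose boundary circle is
collapsed to one more vertex (around which the boundary points appear in reversed order). -/
def diskRotation (C M : Type) (k : ℕ) :
    Equiv.Perm ((C × Fin 4) ⊕ ((M × Bool) ⊕ Fin (2 * k))) :=
  Equiv.sumCongr (Equiv.prodCongr (Equiv.refl C) (finRotate 4))
    (Equiv.sumCongr (Equiv.prodCongr (Equiv.refl M) Equiv.boolNot) (finRotate (2 * k)).symm)

/-- A diagram of a link in real projective space, drawn as a tangle diagram in a disk whose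
boundary points are identified antipodally.  There are finitely many crossings (half-edges as in
`LinkCode`), two-valent vertices `Mark` (with two ends each) and `2 k` tangle ends on the
boundary circle, numbered counterclockwise; `arc` matches the two ends of every edge.
Planarity is Euler's formula `V - E + F = 2 K` for the diagram in the sphere that
arises from the disk by collapsing its boundary, `K` being the number of components. -/
structure ProjectiveLinkDiagram where
  Crossing : Type
  Mark : Type
  k : ℕ
  [fintypeCrossing : Fintype Crossing]
  [decidableEqCrossing : DecidableEq Crossing]
  [finiteMark : Finite Mark]
  arc : Equiv.Perm ((Crossing × Fin 4) ⊕ ((Mark × Bool) ⊕ Fin (2 * k)))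
  arc_arc : ∀ x, arc (arc x) = x
  arc_ne : ∀ x, arc x ≠ x
  planar : cycleCount (diskRotation Crossing Mark k) +
      cycleCount (diskRotation Crossing Mark k * arc) =
    cycleCount arc + 2 * Nat.card (MulAction.orbitRel.Quotient
      (Subgroup.closure {diskRotation Crossing Mark k, arc})
      ((Crossing × Fin 4) ⊕ ((Mark × Bool) ⊕ Fin (2 * k))))

attribute [instance] ProjectiveLinkDiagram.fintypeCrossing
  ProjectiveLinkDiagram.decidableEqCrossing ProjectiveLinkDiagram.finiteMark

namespace ProjectiveLinkDiagram

variable (L : ProjectiveLinkDiagram)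

/-- The points of a disk diagram: ends of edges. -/
abbrev DiskPoint : Type := (L.Crossing × Fin 4) ⊕ ((L.Mark × Bool) ⊕ Fin (2 * L.k))

/-- The diagram in the projective plane: antipodal boundary points are identified. -/
@[reducible]
def code : LinkCode where
  Crossing := L.Crossing
  Aux := (L.Mark × Bool) ⊕ Fin (2 * L.k)
  arc := L.arc
  arc_arc := L.arc_arc
  arc_ne := L.arc_ne
  pass := Sum.map (fun p => (p.1, !p.2)) antipode
  pass_pass := by rintro (⟨p, b⟩ | i) <;> simp [antipode_antipode]
  pass_ne := by rintro (⟨p, b⟩ | i) <;> simp [antipode_ne]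

/-- The points of the plane diagram obtained by adding connecting arcs outside of the disk.  A
boundary point `i` of the disk is now a two-valent vertex with an end `(i, false)` inside the
disk and an end `(i, true)` outside. -/
abbrev PiPoint : Type := (L.Crossing × Fin 4) ⊕ ((L.Mark × Bool) ⊕ (Fin (2 * L.k) × Bool))

/-- The inclusion of the disk. -/
def inside : L.DiskPoint → L.PiPoint
  | Sum.inl p => Sum.inl p
  | Sum.inr (Sum.inl m) => Sum.inr (Sum.inl m)
  | Sum.inr (Sum.inr i) => Sum.inr (Sum.inr (i, false))

/-- The edges of the plane diagram: those in the disk, and for each pair of antipodal boundary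
points a connecting arc outside of the disk. -/
def piArc : L.PiPoint → L.PiPoint
  | Sum.inl p => L.inside (L.arc (Sum.inl p))
  | Sum.inr (Sum.inl m) => L.inside (L.arc (Sum.inr (Sum.inl m)))
  | Sum.inr (Sum.inr (i, false)) => L.inside (L.arc (Sum.inr (Sum.inr i)))
  | Sum.inr (Sum.inr (i, true)) => Sum.inr (Sum.inr (antipode i, true))

theorem piArc_inside (x : L.DiskPoint) : L.piArc (L.inside x) = L.inside (L.arc x) := by
  rcases x with p | m | i <;> rfl

theorem inside_injective : Function.Injective L.inside := by
  rintro (p | m | i) (p2 | m2 | i2) h <;> simp only [inside] at h <;> grind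

theorem inside_or_outside (y : L.PiPoint) :
    (∃ x, y = L.inside x) ∨ ∃ i, y = Sum.inr (Sum.inr (i, true)) := by
  rcases y with p | m | ⟨i, _ | _⟩
  · exact Or.inl ⟨Sum.inl p, rfl⟩
  · exact Or.inl ⟨Sum.inr (Sum.inl m), rfl⟩
  · exact Or.inl ⟨Sum.inr (Sum.inr i), rfl⟩
  · exact Or.inr ⟨i, rfl⟩

/-- The virtual link diagram `π(L)`: the tangle together with connecting arcs, outside of the disk,
between antipodal boundary points.  (Mutual crossings of connecting arcs are virtual.) -/
@[reducible]
def pi : VirtualLinkDiagram where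
  Crossing := L.Crossing
  Aux := (L.Mark × Bool) ⊕ (Fin (2 * L.k) × Bool)
  arc := L.piArc
  arc_arc y := by
    rcases L.inside_or_outside y with ⟨x, rfl⟩ | ⟨i, rfl⟩
    · rw [piArc_inside, piArc_inside, L.arc_arc]
    · simp [piArc, antipode_antipode]
  arc_ne y := by
    rcases L.inside_or_outside y with ⟨x, rfl⟩ | ⟨i, rfl⟩
    · rw [piArc_inside]
      exact fun h => L.arc_ne x (L.inside_injective h)
    · simp [piArc, antipode_ne]
  pass := Sum.map (fun p => (p.1, !p.2)) (fun p => (p.1, !p.2))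
  pass_pass := by rintro (⟨p, b⟩ | ⟨i, b⟩) <;> simp
  pass_ne := by rintro (⟨p, b⟩ | ⟨i, b⟩) <;> simp

/-- The point of the disk to which a point of `π(L)` belongs. -/
def retract : L.PiPoint → L.DiskPoint
  | Sum.inl p => Sum.inl p
  | Sum.inr (Sum.inl m) => Sum.inr (Sum.inl m)
  | Sum.inr (Sum.inr (i, _)) => Sum.inr (Sum.inr i)

theorem retract_inside (x : L.DiskPoint) : L.retract (L.inside x) = x := by
  rcases x with p | m | i <;> rfl

open LinkCode in
/-- Applying `π` to the state circles of a state of `L` gives the state circles of the same state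
of `π(L)`. -/
def piCircle (s : L.Crossing → Bool) :
    Circle (N := L.code) s ≃ Circle (N := L.pi) s where
  toFun := Quot.lift (fun x => circleAt (N := L.pi) s (L.inside x)) (by
    rintro x y (rfl | rfl)
    · exact Quot.sound (Or.inl (L.piArc_inside x).symm)
    · rcases x with p | m | i
      · exact Quot.sound (Or.inr rfl)
      · exact Quot.sound (Or.inr rfl)
      · have h1 : circleAt (N := L.pi) s (Sum.inr (Sum.inr (i, false))) =
            circleAt (N := L.pi) s (Sum.inr (Sum.inr (i, true))) := Quot.sound (Or.inr rfl)
        have h2 : circleAt (N := L.pi) s (Sum.inr (Sum.inr (i, true))) =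
            circleAt (N := L.pi) s (Sum.inr (Sum.inr (antipode i, true))) :=
          Quot.sound (Or.inl rfl)
        have h3 : circleAt (N := L.pi) s (Sum.inr (Sum.inr (antipode i, true))) =
            circleAt (N := L.pi) s (Sum.inr (Sum.inr (antipode i, false))) :=
          Quot.sound (Or.inr rfl)
        exact h1.trans (h2.trans h3))
  invFun := Quot.lift (fun y => circleAt (N := L.code) s (L.retract y)) (by
    rintro x y (rfl | rfl)
    · rcases L.inside_or_outside x with ⟨x, rfl⟩ | ⟨i, rfl⟩
      · have h : L.retract (L.pi.arc (L.inside x)) = L.arc x :=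
          (congrArg L.retract (L.piArc_inside x)).trans (L.retract_inside _)
        rw [h, retract_inside]
        exact Quot.sound (Or.inl rfl)
      · exact Quot.sound (Or.inr rfl)
    · rcases x with p | m | ⟨i, b⟩
      · exact Quot.sound (Or.inr rfl)
      · exact Quot.sound (Or.inr rfl)
      · rfl)
  left_inv := by
    rintro ⟨x⟩
    exact congrArg (circleAt (N := L.code) s) (L.retract_inside x)
  right_inv := by
    rintro ⟨y⟩
    rcases L.inside_or_outside y with ⟨x, rfl⟩ | ⟨i, rfl⟩
    · exact congrArg (circleAt (N := L.pi) s) (congrArg L.inside (L.retract_inside x))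
    · exact Quot.sound (Or.inr rfl)

/-- `s ↦ π(s)` on states whose circles are labelled by `1` and `X`. -/
def piEnhanced (i : ℕ) (e : L.code.Enhanced i) : L.pi.Enhanced i :=
  ⟨⟨e.1.1, fun a => e.1.2 ((L.piCircle e.1.1).symm a)⟩, e.2⟩

/-- The linear map `α` with `α [s] = [π(s)]`. -/
noncomputable def alpha (i : ℕ) : L.code.Cochain i →ₗ[ℚ] L.pi.Cochain i :=
  Finsupp.lmapDomain ℚ ℚ (L.piEnhanced i)

end ProjectiveLinkDiagram

/-! ## The Frobenius algebra and the common part of the two differentials -/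

/-- Structure constants of `m : V ⊗ V → V` for the basis `1` (`false`), `X` (`true`): the coefficient
of the third argument in the product of the first two. -/
def mulCoeff : Bool → Bool → Bool → ℚ
  | false, false, false => 1
  | false, true, true => 1
  | true, false, true => 1
  | _, _, _ => 0

/-- Structure constants of `Δ : V → V ⊗ V`: the coefficient of the tensor product of the second and
third argument in the coproduct of the first, `Δ 1 = 1 ⊗ X + X ⊗ 1`, `Δ X = X ⊗ X`. -/
def comulCoeff : Bool → Bool → Bool → ℚ
  | false, false, true => 1
  | false, true, false => 1
  | true, true, true => 1
  | _, _, _ => 0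

/-- The factor by which the basis vector `a` changes when it is barred `n` times. -/
def barSign (a : Bool) (n : ℕ) : ℚ := if a = true then (-1) ^ n else 1

/-- The sign of the permutation that rearranges a finite family from the order given by the injective
function `f` to the order given by the injective function `g` (parity of the inversions). -/
noncomputable def permSign {ι : Type} (f g : ι → ℕ) : ℚ :=
  (-1) ^ Nat.card {p : ι × ι // f p.1 < f p.2 ∧ g p.2 < g p.1}

/-- The locally consistent orientation at a crossing whose south-west half-edge is `r`: its value
at the half-edge `i` is `true` if `i` is oriented away from the crossing.  South-west and north-east
point to the crossing, south-east and north-west away from it. -/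
def sourceSink (r i : Fin 4) : Bool := decide (i ≠ r ∧ i ≠ r + 2)

namespace LinkCode

variable {N : LinkCode}

/-- A numbering of the circles of every state. -/
abbrev Numbering (N : LinkCode) : Type :=
  ∀ s : N.KState, Circle s ≃ Fin (Nat.card (Circle s))

open Classical in
/-- Position of a circle when the circle through `y₁` is promoted to the first position, that through
`y₂` to the next, and the other circles follow in the order given by `f`. -/
noncomputable def promoted {s : N.KState} (y₁ y₂ : N.Point) (f : Circle s → ℕ) (a : Circle s) : ℕ :=
  if a = circleAt s y₁ then 0 else if a = circleAt s y₂ then 1 else 2 + f a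

/-- The permutation sign of an edge from `s` to `t` of the cube: the product of the signs of the
permutation that promotes the circles at the site before the bifurcation, and of the one that leads
from the new circles, followed by the untouched circles in the old order, to the numbering at `t`. -/
noncomputable def permutationRule (num : N.Numbering) (s t : N.KState) (y₁ y₂ : N.Point) : ℚ :=
  permSign (fun a : Circle s => (num s a : ℕ)) (promoted y₁ y₂ fun a => (num s a : ℕ)) *
    permSign (promoted y₁ y₂ fun b : Circle t => (num s (carry s b) : ℕ))
      (fun b : Circle t => (num t b : ℕ))

open Classical in
/-- A matrix entry of the map on an edge of the cube.  The state `t` arises from `s` by changing an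
`A`-smoothing into a `B`-smoothing, where `y₁`, `y₂` are points on the first and the second
arc of the site (of both smoothings); `v` and `w` label the circles before and after.  The map is `m`
for two circles becoming one, `Δ` for one becoming two, and zero for one becoming one.
Besides the permutation rule, algebra elements are barred `pre y` times before and `post y` times
after the bifurcation on the circle that meets the site in `y`, and `far a` times on
a circle `a` that does not meet the site. -/
noncomputable def edgeCoeff (num : N.Numbering) (s t : N.KState) (y₁ y₂ : N.Point)
    (pre post : N.Point → ℕ) (far : Circle s → ℕ)
    (v : Circle s → Bool) (w : Circle t → Bool) : ℚ :=
  if ∀ x, circleAt s x ≠ circleAt s y₁ → circleAt s x ≠ circleAt s y₂ →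
      w (circleAt t x) = v (circleAt s x) then
    permutationRule num s t y₁ y₂ *
    (∏ a : Circle s,
      if a = circleAt s y₁ ∨ a = circleAt s y₂ then 1 else barSign (v a) (far a)) *
    (if circleAt s y₁ ≠ circleAt s y₂ then
      barSign (v (circleAt s y₁)) (pre y₁) * barSign (v (circleAt s y₂)) (pre y₂) *
        mulCoeff (v (circleAt s y₁)) (v (circleAt s y₂)) (w (circleAt t y₁)) *
        barSign (w (circleAt t y₁)) (post y₁)
    else if circleAt t y₁ ≠ circleAt t y₂ then
      barSign (v (circleAt s y₁)) (pre y₁) *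
        comulCoeff (v (circleAt s y₁)) (w (circleAt t y₁)) (w (circleAt t y₂)) *
        barSign (w (circleAt t y₁)) (post y₁) * barSign (w (circleAt t y₂)) (post y₂)
    else 0)
  else 0

/-- The linear map from degree `i` to degree `i + 1` that is the sum, over all crossings `c` with
an `A`-smoothing, of the edge maps with the given matrix entries. -/
noncomputable def cubeDifferential
    (E : ∀ (s t : N.KState), N.Crossing → (Circle s → Bool) → (Circle t → Bool) → ℚ) (i : ℕ) :
    N.Cochain i →ₗ[ℚ] N.Cochain (i + 1) :=
  Finsupp.linearCombination ℚ fun e => Finsupp.equivFunOnFinite.symm fun e' =>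
    ∑ c : N.Crossing, if e.1.1 c = false ∧ e'.1.1 = Function.update e.1.1 c true then
      E e.1.1 e'.1.1 c e.1.2 e'.1.2 else 0

/-- The submodule of coboundaries in degree `i`. -/
noncomputable def coboundaries (d : ∀ i, N.Cochain i →ₗ[ℚ] N.Cochain (i + 1)) :
    ∀ i, Submodule ℚ (N.Cochain i)
  | 0 => ⊥
  | i + 1 => LinearMap.range (d i)

/-- The cohomology in degree `i`: cocycles modulo coboundaries. -/
abbrev Cohomology (d : ∀ i, N.Cochain i →ₗ[ℚ] N.Cochain (i + 1)) (i : ℕ) : Type :=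
  LinearMap.ker (d i) ⧸ (coboundaries d i).submoduleOf (LinearMap.ker (d i))

/-- Local orientations of the two strands at every crossing, given by the half-edge that points
south-west when the crossing is turned such that both strands go upwards: the half-edges `r`, `r + 1`,
`r + 2`, `r + 3` then are south-west, south-east (both incoming), north-east and north-west. -/
abbrev LocalOrientation (N : LinkCode) : Type := N.Crossing → Fin 4

/-- The point at the south-west end of a crossing: it lies on the western arc of one smoothing and on
the southern arc of the other. -/
def firstSite (ℓ : N.LocalOrientation) (c : N.Crossing) : N.Point := Sum.inl (c, ℓ c)

/-- The point at the north-east end of a crossing: it lies on the eastern arc of one smoothing and on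
the northern arc of the other. -/
def secondSite (ℓ : N.LocalOrientation) (c : N.Crossing) : N.Point := Sum.inl (c, ℓ c + 2)

/-! ## The complex of Manolescu and Willis -/

/-- The choices in the Manolescu-Willis complex: a numbering and orientations of the circles of every
state.  `orient s x` is `true` if the circle of `s` through `x` is oriented, at `x`, away from the
vertex to which `x` belongs. -/
structure MWChoices (N : LinkCode) where
  num : N.Numbering
  orient : N.KState → N.Point → Bool
  orient_arc : ∀ s x, orient s (N.arc x) = !orient s x
  orient_joint : ∀ s x, orient s (joint s x) = !orient s x

/-- Nearby consistency: whether the orientation `f` of the circle and the locally consistent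
orientation mismatch at a point of a crossing. -/
def nearbyMismatch (ℓ : N.LocalOrientation) (f : N.Point → Bool) : N.Point → ℕ
  | Sum.inl (c, i) => if f (Sum.inl (c, i)) = sourceSink (ℓ c) i then 0 else 1
  | Sum.inr _ => 0

/-- Far orientations: whether the orientations before and after differ on a circle. -/
noncomputable def farMismatch (M : N.MWChoices) (s t : N.KState) (a : Circle s) : ℕ :=
  if M.orient s (Quot.out a) = M.orient t (Quot.out a) then 0 else 1

/-- The differential of the unlabeled Manolescu-Willis complex (the same algebra `V` is used for
the circles of class 0 and of class 1). -/
noncomputable def mwDifferential (ℓ : N.LocalOrientation) (M : N.MWChoices) (i : ℕ) :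
    N.Cochain i →ₗ[ℚ] N.Cochain (i + 1) :=
  cubeDifferential (fun s t c =>
    edgeCoeff M.num s t (firstSite ℓ c) (secondSite ℓ c)
      (nearbyMismatch ℓ (M.orient s)) (nearbyMismatch ℓ (M.orient t)) (farMismatch M s t)) i

/-! ## The complex of Dye, Kaestner and Kauffman -/

/-- An orientation of the link; `out x` is `true` if the strand is oriented, at `x`, away from the
vertex to which `x` belongs. -/
structure LinkOrientation (N : LinkCode) where
  out : N.Point → Bool
  out_arc : ∀ x, out (N.arc x) = !out x
  out_cross : ∀ c i, out (Sum.inl (c, i + 2)) = !out (Sum.inl (c, i))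
  out_pass : ∀ q, out (Sum.inr (N.pass q)) = !out (Sum.inr q)

/-- The local orientation near a vertex (`true`: away from the vertex): the source-sink orientation
at a crossing, and the orientation of the link at a two-valent vertex. -/
def localOut (o : N.LinkOrientation) (ℓ : N.LocalOrientation) : N.Point → Bool
  | Sum.inl (c, i) => sourceSink (ℓ c) i
  | Sum.inr q => o.out (Sum.inr q)

/-- The number (0 or 1) of cut points on a half-edge.  There is a cut point if the source-sink
orientation near the crossing does not match the orientation of the link further along. -/
def cutAt (o : N.LinkOrientation) (ℓ : N.LocalOrientation) (x : N.Point) : ℕ :=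
  if localOut o ℓ x = o.out x then 0 else 1

/-- Following a circle of `s`: from a point at which one leaves a vertex along an edge, to the next
such point. -/
def next (s : N.KState) (x : N.Point) : N.Point := joint s (N.arc x)

/-- The number of cut points that one passes on the circle, leaving the vertex of `x` along the edge
at `x` and going on until the smoothed arc through the vertex of `z` that contains `z`. -/
noncomputable def cutsAlong (o : N.LinkOrientation) (ℓ : N.LocalOrientation) (s : N.KState)
    (x z : N.Point) : ℕ :=
  ∑ m ∈ Finset.range (sInf {n : ℕ | (next s)^[n] x = z ∨ (next s)^[n] x = joint s z}),
    (cutAt o ℓ ((next s)^[m] x) + cutAt o ℓ (N.arc ((next s)^[m] x)))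

/-- The first point at which one leaves a vertex, going from the base point `b` in the direction of
the local orientation there. -/
def start (o : N.LinkOrientation) (ℓ : N.LocalOrientation) (s : N.KState) (b : N.Point) : N.Point :=
  if localOut o ℓ b = true then b else joint s b

open Classical in
/-- The end, of the smoothed arc through `y`, at which one leaves the vertex when the circle is
followed in the direction of its orientation, which is the one given by the base point `b`. -/
noncomputable def depart (o : N.LinkOrientation) (ℓ : N.LocalOrientation) (s : N.KState)
    (b y : N.Point) : N.Point :=
  if ∃ n : ℕ, (next s)^[n] (start o ℓ s b) = y then y else joint s y

/-- The choices in the Dye-Kaestner-Kauffman complex: a numbering of the circles of every state, and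
a base point on every circle (which lies next to a vertex, before any cut point). -/
structure DKKChoices (N : LinkCode) where
  num : N.Numbering
  base : ∀ s : N.KState, Circle s → N.Point
  base_mem : ∀ (s : N.KState) (a : Circle s), circleAt s (base s a) = a

/-- The differential of the Dye-Kaestner-Kauffman complex.  Algebra elements are transported, in the
direction of the orientation of the circle, from the base point to the site, from the site to the new
base point, and on the other circles from the old to the new base point; they are barred at each
cut point. -/
noncomputable def dkkDifferential (o : N.LinkOrientation) (ℓ : N.LocalOrientation)
    (D : N.DKKChoices) (i : ℕ) : N.Cochain i →ₗ[ℚ] N.Cochain (i + 1) :=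
  cubeDifferential (fun s t c =>
    edgeCoeff D.num s t (firstSite ℓ c) (secondSite ℓ c)
      (fun y => cutsAlong o ℓ s (start o ℓ s (D.base s (circleAt s y))) y)
      (fun y => cutsAlong o ℓ t (depart o ℓ t (D.base t (circleAt t y)) y)
        (D.base t (circleAt t y)))
      (fun a => cutsAlong o ℓ s (start o ℓ s (D.base s a)) (D.base t (carry t a)))) i

end LinkCode

/-! ## Corresponding choices -/

namespace ProjectiveLinkDiagram

variable (L : ProjectiveLinkDiagram)

/-- Orientations of the circles of a state of `L`, regarded as orientations of the circles of the
corresponding state of `π(L)`. -/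
def piOrient (f : L.code.Point → Bool) : L.pi.Point → Bool
  | Sum.inl p => f (Sum.inl p)
  | Sum.inr (Sum.inl m) => f (Sum.inr (Sum.inl m))
  | Sum.inr (Sum.inr (i, false)) => f (Sum.inr (Sum.inr i))
  | Sum.inr (Sum.inr (i, true)) => !f (Sum.inr (Sum.inr i))

/-- The Manolescu-Willis choices for `L` correspond to the Dye-Kaestner-Kauffman choices for `π(L)`:
the circles are numbered in the same way, and every circle has the direction of the local orientation
at its base point. -/
structure Corresponding (o : L.pi.LinkOrientation) (ℓ : L.pi.LocalOrientation)
    (M : L.code.MWChoices) (D : L.pi.DKKChoices) : Prop where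
  num : ∀ (s : L.code.KState) (a : LinkCode.Circle s),
    (M.num s a : ℕ) = (D.num s (L.piCircle s a) : ℕ)
  orient : ∀ (s : L.pi.KState) (a : LinkCode.Circle s),
    L.piOrient (M.orient s) (D.base s a) = LinkCode.localOut o ℓ (D.base s a)

end ProjectiveLinkDiagram

/-!
The two differentials are built from the same data except for the numbers of bars, so everything
reduces to comparing parities.  Fix a state of `π(L)` and an orientation `f` of its circles, and let
`localSgn` be the sign, at each point, that compares `f` with the local orientation (source-sink
at a crossing, the orientation of the link at a two-valent vertex).

* Between the two ends of a smoothed arc both sides of this comparison change, because `01`, `23`,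
  `03` and `12` all join an incoming to an outgoing half-edge of the source-sink orientation; so
  `localSgn` is the same at the two ends.  Along an edge,
  `localSgn` changes exactly if the edge carries an odd number of cut points, as the orientation of
  the link is coherent there.  Hence the parity of the number of cut points between two points of
  a circle is the product of the values of `localSgn` at the two points (`neg_one_pow_cutsAlong`).
  The direction in which the circle is followed does not matter for this.
* For corresponding choices `f` is the local orientation at the base point, so `localSgn` is `1` there.
  The cut points between the base point and the site then count the nearby mismatch of Manolescu and
  Willis, and the cut points between the old and the new base point of a circle away from the site
  count its far mismatch.  For the latter, a circle away from the site is the same curve in both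
  states, and whether two orientations of it agree can be tested at any of its points
  (`boolSgn_mul_eq_of_offSite`).
* Both theories thus have the same matrix entries (`edgeCoeff_pi`, `edgeCoeff_of_corresponding`), and
  `α`, which comes from a bijection of bases, is an isomorphism of complexes.

Corresponding choices exist because state circles can be oriented: following a circle in one direction
one leaves every smoothed arc of it at exactly one end
(`exists_iterate_next_of_circleAt_eq`, `not_iterate_next_eq_and_eq_joint`).  That it is not both ends is
a fact on two fixed-point-free involutions `a` and `b` (the edges and the smoothed arcs): a word of odd
length in them is conjugate to `a` or `b`, and so has no fixed point.
-/

/-! ### Signs and involutions -/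

/-- A Boolean as a sign: `true` is `1` and `false` is `-1`. -/
def boolSgn (b : Bool) : ℚ := if b = true then 1 else -1

theorem boolSgn_not (b : Bool) : boolSgn (!b) = -boolSgn b := by
  cases b <;> simp [boolSgn]

theorem boolSgn_mul_self (b : Bool) : boolSgn b * boolSgn b = 1 := by
  cases b <;> simp [boolSgn]

theorem neg_one_pow_mismatch (p q : Bool) :
    (-1 : ℚ) ^ (if p = q then 0 else 1) = boolSgn p * boolSgn q := by
  cases p <;> cases q <;> simp [boolSgn]

theorem barSign_congr (a : Bool) {m n : ℕ} (h : (-1 : ℚ) ^ m = (-1) ^ n) :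
    barSign a m = barSign a n := by
  simp [barSign, h]

theorem permSign_comp_equiv {ι κ : Type} (e : ι ≃ κ) (f g : κ → ℕ) :
    permSign (fun a => f (e a)) (fun a => g (e a)) = permSign f g := by
  unfold permSign
  congr 1
  exact Nat.card_congr ((e.prodCongr e).subtypeEquiv fun p => Iff.rfl)

/-- Odd words in two fixed-point-free involutions have no fixed points. -/
theorem iterate_comp_ne_of_fixedPointFree {α : Type*} {a b : α → α}
    (ha : Function.Involutive a) (hb : Function.Involutive b)
    (ha' : ∀ x, a x ≠ x) (hb' : ∀ x, b x ≠ x) :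
    ∀ (n : ℕ) (x : α), (fun y => b (a y))^[n] x ≠ b x
  | 0, x, h => hb' x h.symm
  | 1, x, h => ha' x (hb.injective h)
  | n + 2, x, h => by
    rw [Function.iterate_succ_apply'] at h
    have h2 := ha.eq_iff.mp (hb.injective h)
    rw [Function.iterate_succ_apply] at h2
    refine iterate_comp_ne_of_fixedPointFree ha hb ha' hb' n (b (a x)) ?_
    rw [h2, hb]

/-! ### Smoothings and state circles -/

theorem smoothing_smoothing (b : Bool) (i : Fin 4) : smoothing b (smoothing b i) = i := by
  revert b i; decide

theorem smoothing_ne (b : Bool) (i : Fin 4) : smoothing b i ≠ i := by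
  revert b i; decide

theorem sourceSink_smoothing (b : Bool) (r i : Fin 4) :
    sourceSink r (smoothing b i) = !sourceSink r i := by
  revert b r i; decide

/-- Under both smoothings, the south-west and the north-east end lie on different arcs, so that every
half-edge of the crossing lies on the arc of one of them. -/
theorem eq_site_or_eq_smoothing_site (b : Bool) (r i : Fin 4) :
    (i = r ∨ i = smoothing b r) ∨ i = r + 2 ∨ i = smoothing b (r + 2) := by
  revert b r i; decide

namespace LinkCode

variable {N : LinkCode}

theorem joint_joint (s : N.KState) (x : N.Point) : joint s (joint s x) = x := by
  rcases x with ⟨c, i⟩ | q <;> simp [joint, smoothing_smoothing, N.pass_pass]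

theorem joint_ne (s : N.KState) (x : N.Point) : joint s x ≠ x := by
  rcases x with ⟨c, i⟩ | q <;> simp [joint, smoothing_ne, N.pass_ne]

theorem circleAt_joint (s : N.KState) (x : N.Point) : circleAt s (joint s x) = circleAt s x := by
  symm
  exact Quot.sound (Or.inr rfl)

theorem circleAt_arc (s : N.KState) (x : N.Point) : circleAt s (N.arc x) = circleAt s x := by
  symm
  exact Quot.sound (Or.inl rfl)

theorem circleAt_out {s : N.KState} (a : Circle s) : circleAt s (Quot.out a) = a :=
  Quot.out_eq a

theorem next_injective (s : N.KState) : Function.Injective (next s) :=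
  (Function.LeftInverse.injective (joint_joint s)).comp
    (Function.LeftInverse.injective N.arc_arc)

theorem arc_eq_joint_next (s : N.KState) (x : N.Point) : N.arc x = joint s (next s x) :=
  (joint_joint s _).symm

/-- A function on the points that does not change along the arcs and joints of a set of state circles
is constant on each circle of the set. -/
theorem eq_of_circleAt_eq {β : Type*} {s : N.KState} (P : Circle s → Prop) (F : N.Point → β)
    (harc : ∀ x, P (circleAt s x) → F (N.arc x) = F x)
    (hjoint : ∀ x, P (circleAt s x) → F (joint s x) = F x)
    {x y : N.Point} (h : circleAt s x = circleAt s y) (hx : P (circleAt s x)) : F x = F y := by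
  classical
  have key : ∀ x y : N.Point, (y = N.arc x ∨ y = joint s x) →
      (if P (circleAt s x) then some (F x) else none) =
        if P (circleAt s y) then some (F y) else none := by
    rintro x y (rfl | rfl)
    · rw [circleAt_arc]
      split_ifs with hp
      · rw [harc x hp]
      · rfl
    · rw [circleAt_joint]
      split_ifs with hp
      · rw [hjoint x hp]
      · rfl
  have h2 := congrArg (Quot.lift _ key) h
  change (if P (circleAt s x) then some (F x) else none) =
        if P (circleAt s y) then some (F y) else none at h2
  rw [if_pos hx, if_pos (h ▸ hx)] at h2
  exact Option.some.inj h2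

/-! ### Following a state circle -/

/-- The points from which one departs, starting from `p`, form a full cycle of `next s`. -/
theorem exists_iterate_next_iff (s : N.KState) (p x : N.Point) :
    (∃ n : ℕ, (next s)^[n] p = next s x) ↔ ∃ n : ℕ, (next s)^[n] p = x := by
  constructor
  · rintro ⟨_ | n, h⟩
    · -- The walk is periodic, so `x` is the point before the return to `p = next s x`.
      obtain ⟨m, hm, hm2⟩ := (next_injective s).mem_periodicPts x
      obtain ⟨k, rfl⟩ := Nat.exists_eq_add_of_lt hm
      refine ⟨k, ?_⟩
      change p = next s x at h
      rw [h, ← Function.iterate_succ_apply]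
      simpa [Function.IsPeriodicPt, Function.IsFixedPt] using hm2
    · rw [Function.iterate_succ_apply'] at h
      exact ⟨n, next_injective s h⟩
  · rintro ⟨n, rfl⟩
    exact ⟨n + 1, Function.iterate_succ_apply' _ _ _⟩

/-- Following a circle in one direction, one departs from every one of its smoothed arcs. -/
theorem exists_iterate_next_of_circleAt_eq {s : N.KState} {p x : N.Point}
    (h : circleAt s p = circleAt s x) :
    ∃ n : ℕ, (next s)^[n] p = x ∨ (next s)^[n] p = joint s x := by
  -- The set of the points from which one departs, and their partners, is closed under both involutions.
  let F : N.Point → Prop := fun x => (∃ n : ℕ, (next s)^[n] p = x) ∨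
    ∃ n : ℕ, (next s)^[n] p = joint s x
  have hF : F p ↔ F x := by
    refine iff_of_eq <| eq_of_circleAt_eq (fun _ => True) F (fun x _ => ?_) (fun x _ => ?_) h trivial
    · have h1 := exists_iterate_next_iff s p x
      have h2 := exists_iterate_next_iff s p (N.arc x)
      rw [arc_eq_joint_next s x] at h2 ⊢
      have h3 : next s (joint s (next s x)) = joint s x := by
        rw [← arc_eq_joint_next, next, N.arc_arc]
      rw [h3] at h2
      simp only [F, joint_joint, eq_iff_iff]
      tauto
    · simp only [F, joint_joint, eq_iff_iff]
      tauto
  obtain ⟨n, hn⟩ | ⟨n, hn⟩ := hF.mp (Or.inl ⟨0, rfl⟩)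
  · exact ⟨n, Or.inl hn⟩
  · exact ⟨n, Or.inr hn⟩

/-- Following a circle in one direction, one never departs from both ends of a smoothed arc, so
that state circles can be oriented. -/
theorem not_iterate_next_eq_and_eq_joint (s : N.KState) (p x : N.Point) :
    ¬ ((∃ n : ℕ, (next s)^[n] p = x) ∧ ∃ n : ℕ, (next s)^[n] p = joint s x) := by
  have key := iterate_comp_ne_of_fixedPointFree (N.arc_arc) (joint_joint s) N.arc_ne (joint_ne s)
  rintro ⟨⟨n, hn⟩, m, hm⟩
  rcases le_total n m with h | h <;> obtain ⟨k, rfl⟩ := Nat.exists_eq_add_of_le' h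
  · rw [Function.iterate_add_apply, hn] at hm
    exact key k x hm
  · rw [Function.iterate_add_apply, hm] at hn
    exact key k (joint s x) (hn.trans (joint_joint s x).symm)

/-- `f` orients the circles of the state `s`: `f x` is `true` if the circle is oriented, at `x`, away
from the vertex of `x`. -/
structure OrientsCircles (s : N.KState) (f : N.Point → Bool) : Prop where
  arc : ∀ x, f (N.arc x) = !f x
  joint : ∀ x, f (joint s x) = !f x

theorem OrientsCircles.next {s : N.KState} {f : N.Point → Bool} (hf : OrientsCircles s f)
    (x : N.Point) : f (next s x) = f x := by
  rw [LinkCode.next, hf.joint, hf.arc, Bool.not_not]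

theorem localOut_joint (o : N.LinkOrientation) (ℓ : N.LocalOrientation) (s : N.KState)
    (x : N.Point) : localOut o ℓ (joint s x) = !localOut o ℓ x := by
  rcases x with ⟨c, i⟩ | q
  · exact sourceSink_smoothing _ _ _
  · exact o.out_pass q

theorem circleAt_start (o : N.LinkOrientation) (ℓ : N.LocalOrientation) (s : N.KState)
    (b : N.Point) : circleAt s (start o ℓ s b) = circleAt s b := by
  unfold start
  split_ifs
  · rfl
  · exact circleAt_joint s b

theorem circleAt_depart (o : N.LinkOrientation) (ℓ : N.LocalOrientation) (s : N.KState)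
    (b y : N.Point) : circleAt s (depart o ℓ s b y) = circleAt s y := by
  unfold depart
  split_ifs
  · rfl
  · exact circleAt_joint s y

/-- The circles of a state can be oriented by the local orientations at base points. -/
theorem exists_orientsCircles (o : N.LinkOrientation) (ℓ : N.LocalOrientation) (s : N.KState)
    (base : Circle s → N.Point) (hbase : ∀ a, circleAt s (base a) = a) :
    ∃ f : N.Point → Bool, OrientsCircles s f ∧ ∀ a, f (base a) = localOut o ℓ (base a) := by
  classical
  let p : N.Point → N.Point := fun x => start o ℓ s (base (circleAt s x))
  let f : N.Point → Bool := fun x => decide (∃ n : ℕ, (next s)^[n] (p x) = x)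
  have hp : ∀ x, circleAt s (p x) = circleAt s x := fun x =>
    (circleAt_start o ℓ s _).trans (hbase _)
  have hjoint : ∀ x, f (joint s x) = !f x := by
    intro x
    have h1 := not_iterate_next_eq_and_eq_joint s (p x) x
    have h2 := exists_iterate_next_of_circleAt_eq (hp x)
    rw [exists_or] at h2
    have hpj : p (joint s x) = p x := by simp only [p, circleAt_joint]
    by_cases h3 : ∃ n : ℕ, (next s)^[n] (p x) = x
    · have h4 : ¬ ∃ n : ℕ, (next s)^[n] (p x) = joint s x := fun h => h1 ⟨h3, h⟩
      simp only [f, hpj, h3, h4, decide_true, decide_false, Bool.not_true]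
    · have h4 : ∃ n : ℕ, (next s)^[n] (p x) = joint s x := h2.resolve_left h3
      simp only [f, hpj, h3, h4, decide_true, decide_false, Bool.not_false]
  refine ⟨f, ⟨fun x => ?_, hjoint⟩, fun a => ?_⟩
  · have hpn : p (next s x) = p x := by simp only [p, next, circleAt_joint, circleAt_arc]
    rw [arc_eq_joint_next s x, hjoint]
    simp only [f, hpn, exists_iterate_next_iff]
  · have hpb : p (base a) = start o ℓ s (base a) := by simp only [p, hbase]
    cases hl : localOut o ℓ (base a) with
    | true =>
      rw [start, if_pos hl] at hpb
      exact decide_eq_true ⟨0, hpb⟩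
    | false =>
      rw [start, if_neg (by simp [hl])] at hpb
      exact decide_eq_false fun h =>
        not_iterate_next_eq_and_eq_joint s _ _ ⟨h, 0, hpb⟩

/-! ### Counting cut points modulo two -/

/-- The sign that compares the orientation `f` with the local orientation at a point. -/
def localSgn (o : N.LinkOrientation) (ℓ : N.LocalOrientation) (f : N.Point → Bool)
    (x : N.Point) : ℚ :=
  boolSgn (localOut o ℓ x) * boolSgn (f x)

theorem localSgn_mul_self (o : N.LinkOrientation) (ℓ : N.LocalOrientation) (f : N.Point → Bool)
    (x : N.Point) : localSgn o ℓ f x * localSgn o ℓ f x = 1 := by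
  rw [localSgn, mul_mul_mul_comm, boolSgn_mul_self, boolSgn_mul_self, one_mul]

theorem localSgn_eq_one {o : N.LinkOrientation} {ℓ : N.LocalOrientation} {f : N.Point → Bool}
    {x : N.Point} (h : f x = localOut o ℓ x) : localSgn o ℓ f x = 1 := by
  rw [localSgn, h, boolSgn_mul_self]

theorem localSgn_joint (o : N.LinkOrientation) (ℓ : N.LocalOrientation) {s : N.KState}
    {f : N.Point → Bool} (hf : OrientsCircles s f) (x : N.Point) :
    localSgn o ℓ f (joint s x) = localSgn o ℓ f x := by
  rw [localSgn, localOut_joint, hf.joint, boolSgn_not, boolSgn_not, neg_mul_neg, localSgn]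

theorem localSgn_start (o : N.LinkOrientation) (ℓ : N.LocalOrientation) {s : N.KState}
    {f : N.Point → Bool} (hf : OrientsCircles s f) (b : N.Point) :
    localSgn o ℓ f (start o ℓ s b) = localSgn o ℓ f b := by
  unfold start
  split_ifs
  · rfl
  · exact localSgn_joint o ℓ hf b

theorem localSgn_depart (o : N.LinkOrientation) (ℓ : N.LocalOrientation) {s : N.KState}
    {f : N.Point → Bool} (hf : OrientsCircles s f) (b y : N.Point) :
    localSgn o ℓ f (depart o ℓ s b y) = localSgn o ℓ f y := by
  unfold depart
  split_ifs
  · rfl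
  · exact localSgn_joint o ℓ hf y

/-- Along an edge, the local orientation changes relative to the orientation of the circle exactly
if the number of cut points on the edge is odd. -/
theorem neg_one_pow_cutAt_add (o : N.LinkOrientation) (ℓ : N.LocalOrientation) {s : N.KState}
    {f : N.Point → Bool} (hf : OrientsCircles s f) (x : N.Point) :
    (-1 : ℚ) ^ (cutAt o ℓ x + cutAt o ℓ (N.arc x)) =
      localSgn o ℓ f x * localSgn o ℓ f (next s x) := by
  rw [pow_add, cutAt, cutAt, neg_one_pow_mismatch, neg_one_pow_mismatch, o.out_arc, boolSgn_not,
    localSgn, localSgn, hf.next, next, localOut_joint, boolSgn_not]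
  have h1 := boolSgn_mul_self (o.out x)
  have h2 := boolSgn_mul_self (f x)
  linear_combination (boolSgn (localOut o ℓ x) * boolSgn (localOut o ℓ (N.arc x))) * (h2 - h1)

/-- The parity of the number of cut points between two points of a circle: it tells whether
the local orientations at the two points induce the same orientation of the circle. -/
theorem neg_one_pow_cutsAlong (o : N.LinkOrientation) (ℓ : N.LocalOrientation) {s : N.KState}
    {f : N.Point → Bool} (hf : OrientsCircles s f) {x z : N.Point}
    (h : circleAt s x = circleAt s z) :
    (-1 : ℚ) ^ cutsAlong o ℓ s x z = localSgn o ℓ f x * localSgn o ℓ f z := by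
  have key : ∀ n : ℕ, (-1 : ℚ) ^ (∑ m ∈ Finset.range n,
      (cutAt o ℓ ((next s)^[m] x) + cutAt o ℓ (N.arc ((next s)^[m] x)))) =
      localSgn o ℓ f x * localSgn o ℓ f ((next s)^[n] x) := by
    intro n
    induction n with
    | zero => simp [localSgn_mul_self]
    | succ n ih =>
      rw [Finset.sum_range_succ, pow_add, ih, neg_one_pow_cutAt_add o ℓ hf,
        Function.iterate_succ_apply', mul_assoc, ← mul_assoc (localSgn o ℓ f ((next s)^[n] x)),
        localSgn_mul_self, one_mul]
  unfold cutsAlong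
  rw [key]
  -- The infimum is attained, since the circle of `x` passes through `z`.
  rcases Nat.sInf_mem (s := {n : ℕ | (next s)^[n] x = z ∨ (next s)^[n] x = joint s z})
    (exists_iterate_next_of_circleAt_eq h) with h2 | h2
  · rw [h2]
  · rw [h2, localSgn_joint o ℓ hf]

theorem neg_one_pow_nearbyMismatch (o : N.LinkOrientation) (ℓ : N.LocalOrientation)
    (f : N.Point → Bool) (c : N.Crossing) (i : Fin 4) :
    (-1 : ℚ) ^ nearbyMismatch ℓ f (Sum.inl (c, i)) = localSgn o ℓ f (Sum.inl (c, i)) :=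
  (neg_one_pow_mismatch _ _).trans (mul_comm _ _)

/-! ### Circles away from the site of a bifurcation -/

/-- The circle `a` does not meet the site of a bifurcation at the crossing `c`. -/
def OffSite (ℓ : N.LocalOrientation) (c : N.Crossing) {s : N.KState} (a : Circle s) : Prop :=
  a ≠ circleAt s (firstSite ℓ c) ∧ a ≠ circleAt s (secondSite ℓ c)

theorem not_offSite (ℓ : N.LocalOrientation) (c : N.Crossing) (s : N.KState) (i : Fin 4) :
    ¬ OffSite ℓ c (circleAt s (Sum.inl (c, i))) := by
  rintro ⟨h1, h2⟩
  rcases eq_site_or_eq_smoothing_site (s c) (ℓ c) i with (rfl | rfl) | rfl | rfl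
  · exact h1 rfl
  · exact h1 (circleAt_joint s (Sum.inl (c, ℓ c)))
  · exact h2 rfl
  · exact h2 (circleAt_joint s (Sum.inl (c, ℓ c + 2)))

variable {ℓ : N.LocalOrientation} {c : N.Crossing} {s t : N.KState}

theorem joint_eq_of_offSite (hst : ∀ c', c' ≠ c → s c' = t c') {x : N.Point}
    (hx : OffSite ℓ c (circleAt s x)) : joint t x = joint s x := by
  rcases x with ⟨c', i⟩ | q
  · have hc : c' ≠ c := by
      rintro rfl
      exact not_offSite ℓ c' s i hx
    simp only [joint, hst c' hc]
  · rfl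

/-- Away from the site, the circles of the state before the bifurcation are circles of the state
after it. -/
theorem circleAt_eq_of_offSite (hst : ∀ c', c' ≠ c → s c' = t c') {x y : N.Point}
    (hx : OffSite ℓ c (circleAt s x)) (h : circleAt s x = circleAt s y) :
    circleAt t x = circleAt t y :=
  eq_of_circleAt_eq (OffSite ℓ c) (circleAt t) (fun z _ => circleAt_arc t z)
    (fun z hz => by rw [← joint_eq_of_offSite hst hz, circleAt_joint]) h hx

/-- A circle away from the site does not run into the site after the bifurcation. -/
theorem OffSite.circleAt (hst : ∀ c', c' ≠ c → s c' = t c') {x : N.Point}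
    (hx : OffSite ℓ c (circleAt s x)) : OffSite ℓ c (circleAt t x) := by
  -- The four ends at `c` are not off the site in `s`, and elsewhere the joints of `s` and `t` agree.
  -- Therefore being off the site in `s` is constant along the circles of `t`.
  let F : N.Point → Prop := fun x => OffSite ℓ c (LinkCode.circleAt s x)
  have key : ∀ i, LinkCode.circleAt t x ≠ LinkCode.circleAt t (Sum.inl (c, i)) := by
    intro i h
    have hF : F x ↔ F (Sum.inl (c, i)) := by
      refine iff_of_eq <| eq_of_circleAt_eq (fun _ => True) F (fun z _ => ?_) (fun z _ => ?_) h trivial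
      · simp only [F, circleAt_arc]
      · simp only [F]
        rcases z with ⟨c', j⟩ | q
        · by_cases hc : c' = c
          · subst hc
            exact propext (iff_of_false (not_offSite ℓ c' s _) (not_offSite ℓ c' s _))
          · have : joint t (Sum.inl (c', j)) = joint s (Sum.inl (c', j)) := by
              simp only [joint, hst c' hc]
            rw [this, circleAt_joint]
        · exact congrArg (OffSite ℓ c) (circleAt_joint s (Sum.inr q))
    exact not_offSite ℓ c s i (hF.mp hx)
  exact ⟨key _, key _⟩

/-- Whether two orientations of the circles before and after the bifurcation agree is the same
everywhere on a circle away from the site. -/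
theorem boolSgn_mul_eq_of_offSite (hst : ∀ c', c' ≠ c → s c' = t c') {f g : N.Point → Bool}
    (hf : OrientsCircles s f) (hg : OrientsCircles t g) {x y : N.Point}
    (hx : OffSite ℓ c (circleAt s x)) (h : circleAt s x = circleAt s y) :
    boolSgn (f x) * boolSgn (g x) = boolSgn (f y) * boolSgn (g y) :=
  eq_of_circleAt_eq (OffSite ℓ c) (fun x => boolSgn (f x) * boolSgn (g x))
    (fun z _ => by simp only [hf.arc, hg.arc, boolSgn_not, neg_mul_neg])
    (fun z hz => by
      have h2 := hg.joint z
      rw [joint_eq_of_offSite hst hz] at h2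
      simp only [hf.joint, h2, boolSgn_not, neg_mul_neg]) h hx

end LinkCode

/-! ### From the projective diagram to the virtual diagram -/

namespace ProjectiveLinkDiagram

open LinkCode

variable (L : ProjectiveLinkDiagram)

theorem piCircle_symm_circleAt (s : L.Crossing → Bool) (y : L.PiPoint) :
    (L.piCircle s).symm (circleAt (N := L.pi) s y) = circleAt (N := L.code) s (L.retract y) :=
  rfl

theorem piCircle_circleAt_retract (s : L.Crossing → Bool) (y : L.PiPoint) :
    L.piCircle s (circleAt (N := L.code) s (L.retract y)) = circleAt (N := L.pi) s y := by
  rw [← piCircle_symm_circleAt, Equiv.apply_symm_apply]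

theorem piCircle_eq_circleAt_iff {s : L.Crossing → Bool} (a : Circle (N := L.code) s)
    (y : L.PiPoint) : L.piCircle s a = circleAt (N := L.pi) s y ↔
      a = circleAt (N := L.code) s (L.retract y) := by
  rw [← piCircle_circleAt_retract, (L.piCircle s).injective.eq_iff]

theorem offSite_piCircle {ℓ : L.Crossing → Fin 4} {c : L.Crossing} {s : L.Crossing → Bool}
    {a : Circle (N := L.code) s} :
    OffSite (N := L.pi) ℓ c (L.piCircle s a) ↔ OffSite (N := L.code) ℓ c a :=
  and_congr (not_congr (L.piCircle_eq_circleAt_iff _ _))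
    (not_congr (L.piCircle_eq_circleAt_iff _ _))

theorem piOrient_inside (f : L.code.Point → Bool) (x : L.DiskPoint) :
    L.piOrient f (L.inside x) = f x := by
  rcases x with p | m | i <;> rfl

theorem orientsCircles_piOrient {s : L.Crossing → Bool} {f : L.code.Point → Bool}
    (hf : OrientsCircles (N := L.code) s f) :
    OrientsCircles (N := L.pi) s (L.piOrient f) := by
  refine ⟨fun y => ?_, fun y => ?_⟩
  · rcases L.inside_or_outside y with ⟨x, rfl⟩ | ⟨i, rfl⟩
    · change L.piOrient f (L.piArc (L.inside x)) = _
      rw [L.piArc_inside, piOrient_inside, piOrient_inside]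
      exact hf.arc x
    · exact congrArg Bool.not (hf.joint (Sum.inr (Sum.inr i)))
  · rcases y with ⟨c, i⟩ | m | ⟨i, _ | _⟩
    · exact hf.joint (Sum.inl (c, i))
    · exact hf.joint (Sum.inr (Sum.inl m))
    · rfl
    · exact (Bool.not_not _).symm

/-- Orientations of the circles of a state of `π(L)` restrict to orientations of the circles of
the same state of `L`. -/
theorem exists_piOrient_eq {s : L.Crossing → Bool} {g : L.pi.Point → Bool}
    (hg : OrientsCircles (N := L.pi) s g) :
    ∃ f : L.code.Point → Bool, OrientsCircles (N := L.code) s f ∧ L.piOrient f = g := by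
  refine ⟨fun x => g (L.inside x), ⟨fun x => ?_, fun x => ?_⟩, funext fun y => ?_⟩
  · rw [← L.piArc_inside]
    exact hg.arc (L.inside x)
  · rcases x with ⟨c, i⟩ | m | i
    · exact hg.joint (Sum.inl (c, i))
    · exact hg.joint (Sum.inr (Sum.inl m))
    · -- From `i` one leaves the disk, follows the connecting arc, and enters the disk again.
      have h1 := hg.joint (Sum.inr (Sum.inr (i, false)))
      have h2 := hg.arc (Sum.inr (Sum.inr (i, true)))
      have h3 := hg.joint (Sum.inr (Sum.inr (antipode i, true)))
      change g (Sum.inr (Sum.inr (i, true))) = _ at h1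
      change g (Sum.inr (Sum.inr (antipode i, true))) = _ at h2
      change g (Sum.inr (Sum.inr (antipode i, false))) = _ at h3
      change g (Sum.inr (Sum.inr (antipode i, false))) = !g (Sum.inr (Sum.inr (i, false)))
      rw [h3, h2, h1, Bool.not_not]
  · rcases y with p | m | ⟨i, _ | _⟩
    · rfl
    · rfl
    · rfl
    · exact (hg.joint (Sum.inr (Sum.inr (i, false)))).symm

/-- Passing to the circle of the other state commutes with `π` for a circle away from the site. -/
theorem carry_piCircle {ℓ : L.Crossing → Fin 4} {c : L.Crossing} {s t : L.Crossing → Bool}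
    (hst : ∀ c', c' ≠ c → s c' = t c') {a : Circle (N := L.code) s}
    (ha : OffSite (N := L.code) ℓ c a) :
    carry (N := L.pi) t (L.piCircle s a) = L.piCircle t (carry (N := L.code) t a) := by
  have h1 : circleAt (N := L.code) s (L.retract (Quot.out (L.piCircle s a))) = a := by
    rw [← piCircle_symm_circleAt, circleAt_out, Equiv.symm_apply_apply]
  have h2 := circleAt_eq_of_offSite (N := L.code) hst (h1.symm ▸ ha)
    (h1.trans (circleAt_out (N := L.code) a).symm)
  rw [carry, carry, ← h2, piCircle_circleAt_retract]

theorem promoted_piCircle {ℓ : L.Crossing → Fin 4} {c : L.Crossing} {s : L.Crossing → Bool}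
    {f : Circle (N := L.pi) s → ℕ} {g : Circle (N := L.code) s → ℕ}
    (hfg : ∀ a, OffSite (N := L.code) ℓ c a → f (L.piCircle s a) = g a)
    (a : Circle (N := L.code) s) :
    promoted (N := L.pi) (firstSite ℓ c) (secondSite ℓ c) f (L.piCircle s a) =
      promoted (N := L.code) (firstSite ℓ c) (secondSite ℓ c) g a := by
  have h1 : L.piCircle s a = circleAt (N := L.pi) s (firstSite ℓ c) ↔
      a = circleAt (N := L.code) s (firstSite ℓ c) :=
    L.piCircle_eq_circleAt_iff _ _
  have h2 : L.piCircle s a = circleAt (N := L.pi) s (secondSite ℓ c) ↔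
      a = circleAt (N := L.code) s (secondSite ℓ c) :=
    L.piCircle_eq_circleAt_iff _ _
  unfold promoted
  by_cases h3 : a = circleAt (N := L.code) s (firstSite ℓ c)
  · rw [if_pos h3, if_pos (h1.mpr h3)]
  rw [if_neg h3, if_neg (mt h1.mp h3)]
  by_cases h4 : a = circleAt (N := L.code) s (secondSite ℓ c)
  · rw [if_pos h4, if_pos (h2.mpr h4)]
  rw [if_neg h4, if_neg (mt h2.mp h4), hfg a ⟨h3, h4⟩]

theorem permutationRule_pi {num : L.code.Numbering} {num' : L.pi.Numbering}
    (hnum : ∀ (s : L.code.KState) (a : Circle s), (num s a : ℕ) = (num' s (L.piCircle s a) : ℕ))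
    (ℓ : L.Crossing → Fin 4) {c : L.Crossing} {s t : L.Crossing → Bool}
    (hst : ∀ c', c' ≠ c → s c' = t c') :
    permutationRule num' s t (firstSite ℓ c) (secondSite ℓ c) =
      permutationRule num s t (firstSite ℓ c) (secondSite ℓ c) := by
  unfold permutationRule
  rw [← permSign_comp_equiv (L.piCircle s), ← permSign_comp_equiv (L.piCircle t)]
  simp only [← hnum]
  congr 2
  · funext a
    exact L.promoted_piCircle (fun b _ => (hnum s b).symm) a
  · funext a
    refine L.promoted_piCircle (fun b hb => ?_) a
    rw [L.carry_piCircle (fun c' hc => (hst c' hc).symm) hb, hnum]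

open Classical in
/-- The matrix entries of an edge map only depend on the parities of the numbers of bars, on
the site and on the circles away from the site, and correspond under `π` if these parities do. -/
theorem edgeCoeff_pi {num : L.code.Numbering} {num' : L.pi.Numbering}
    (hnum : ∀ (s : L.code.KState) (a : Circle s), (num s a : ℕ) = (num' s (L.piCircle s a) : ℕ))
    (ℓ : L.Crossing → Fin 4) {c : L.Crossing} {s t : L.Crossing → Bool}
    (hst : ∀ c', c' ≠ c → s c' = t c')
    {pre post : L.code.Point → ℕ} {pre' post' : L.pi.Point → ℕ}
    {far : Circle (N := L.code) s → ℕ} {far' : Circle (N := L.pi) s → ℕ}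
    (hpre : ∀ i, (-1 : ℚ) ^ pre' (Sum.inl (c, i)) = (-1) ^ pre (Sum.inl (c, i)))
    (hpost : ∀ i, (-1 : ℚ) ^ post' (Sum.inl (c, i)) = (-1) ^ post (Sum.inl (c, i)))
    (hfar : ∀ a, OffSite (N := L.code) ℓ c a → (-1 : ℚ) ^ far' (L.piCircle s a) = (-1) ^ far a)
    (v : Circle (N := L.code) s → Bool) (w : Circle (N := L.code) t → Bool) :
    edgeCoeff num' s t (firstSite ℓ c) (secondSite ℓ c) pre' post' far'
        (fun a => v ((L.piCircle s).symm a)) (fun a => w ((L.piCircle t).symm a)) =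
      edgeCoeff num s t (firstSite ℓ c) (secondSite ℓ c) pre post far v w := by
  have hinj : ∀ (u : L.Crossing → Bool) (x y : L.PiPoint),
      circleAt (N := L.pi) u x = circleAt (N := L.pi) u y ↔
        circleAt (N := L.code) u (L.retract x) = circleAt (N := L.code) u (L.retract y) :=
    fun u x y => (L.piCircle u).symm.injective.eq_iff.symm
  have hcond : (∀ x : L.pi.Point,
      circleAt (N := L.pi) s x ≠ circleAt (N := L.pi) s (firstSite ℓ c) →
      circleAt (N := L.pi) s x ≠ circleAt (N := L.pi) s (secondSite ℓ c) →
      w ((L.piCircle t).symm (circleAt (N := L.pi) t x)) =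
        v ((L.piCircle s).symm (circleAt (N := L.pi) s x))) ↔
      ∀ x : L.code.Point,
      circleAt (N := L.code) s x ≠ circleAt (N := L.code) s (firstSite ℓ c) →
      circleAt (N := L.code) s x ≠ circleAt (N := L.code) s (secondSite ℓ c) →
      w (circleAt (N := L.code) t x) = v (circleAt (N := L.code) s x) := by
    constructor
    · intro h x h1 h2
      have := h (L.inside x)
      simp only [ne_eq, hinj, piCircle_symm_circleAt, retract_inside] at this
      exact this h1 h2
    · intro h x h1 h2
      exact h (L.retract x) (mt (hinj s x (firstSite (N := L.pi) ℓ c)).mpr h1)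
        (mt (hinj s x (secondSite (N := L.pi) ℓ c)).mpr h2)
  have hprod : (∏ a : Circle (N := L.pi) s,
      if a = circleAt (N := L.pi) s (firstSite ℓ c) ∨ a = circleAt (N := L.pi) s (secondSite ℓ c)
        then (1 : ℚ) else barSign (v ((L.piCircle s).symm a)) (far' a)) =
      ∏ a : Circle (N := L.code) s,
        if a = circleAt (N := L.code) s (firstSite ℓ c) ∨
          a = circleAt (N := L.code) s (secondSite ℓ c) then (1 : ℚ) else barSign (v a) (far a) := by
    rw [← Equiv.prod_comp (L.piCircle s)]
    refine Finset.prod_congr rfl fun a _ => ?_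
    have h1 : (L.piCircle s a = circleAt (N := L.pi) s (firstSite ℓ c) ∨
        L.piCircle s a = circleAt (N := L.pi) s (secondSite ℓ c)) ↔
        (a = circleAt (N := L.code) s (firstSite ℓ c) ∨
          a = circleAt (N := L.code) s (secondSite ℓ c)) :=
      or_congr (L.piCircle_eq_circleAt_iff _ _) (L.piCircle_eq_circleAt_iff _ _)
    rw [Equiv.symm_apply_apply]
    split_ifs with h2 h3 h3
    · rfl
    · exact absurd (h1.mp h2) h3
    · exact absurd (h1.mpr h3) h2
    · exact barSign_congr _ (hfar a (not_or.mp h3))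
  have hpre1 := fun a => barSign_congr a (hpre (ℓ c))
  have hpre2 := fun a => barSign_congr a (hpre (ℓ c + 2))
  have hpost1 := fun a => barSign_congr a (hpost (ℓ c))
  have hpost2 := fun a => barSign_congr a (hpost (ℓ c + 2))
  unfold edgeCoeff
  refine if_congr hcond (congrArg₂ _ (congrArg₂ _ (L.permutationRule_pi hnum ℓ hst) hprod) ?_) rfl
  refine if_congr (not_congr (hinj s (Sum.inl (c, ℓ c)) (Sum.inl (c, ℓ c + 2)))) ?_
    (if_congr (not_congr (hinj t (Sum.inl (c, ℓ c)) (Sum.inl (c, ℓ c + 2)))) ?_ rfl)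
  · simp only [piCircle_symm_circleAt, firstSite, secondSite, hpre1, hpre2, hpost1]
    rfl
  · simp only [piCircle_symm_circleAt, firstSite, secondSite, hpre1, hpost1, hpost2]
    rfl

/-! ### Corresponding choices give the same edge maps -/

variable {L}

/-- The orientations at the base points extend to orientations of all circles, so that there are
Manolescu-Willis choices for `L` that correspond to the given choices for `π(L)`. -/
theorem exists_corresponding (o : L.pi.LinkOrientation) (ℓ : L.Crossing → Fin 4)
    (D : L.pi.DKKChoices) : ∃ M : L.code.MWChoices, L.Corresponding o ℓ M D := by
  have h : ∀ s : L.Crossing → Bool, ∃ f : L.code.Point → Bool,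
      OrientsCircles (N := L.code) s f ∧
      ∀ a : Circle (N := L.pi) s, L.piOrient f (D.base s a) = localOut o ℓ (D.base s a) := by
    intro s
    obtain ⟨g, hg, hgb⟩ := exists_orientsCircles o ℓ s (D.base s) (D.base_mem s)
    obtain ⟨f, hf, rfl⟩ := L.exists_piOrient_eq hg
    exact ⟨f, hf, hgb⟩
  choose f hf hfb using h
  exact ⟨{
    num := fun s => ((L.piCircle s).trans (D.num s)).trans
      (finCongr (Nat.card_congr (L.piCircle s)).symm)
    orient := f
    orient_arc := fun s => (hf s).arc
    orient_joint := fun s => (hf s).joint }, fun _ _ => rfl, hfb⟩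

/-- Cut points on the way between base points and the site count nearby mismatches, and those between
the two base points of a circle away from the site count far mismatches, modulo two. -/
theorem edgeCoeff_of_corresponding {o : L.pi.LinkOrientation} {ℓ : L.Crossing → Fin 4}
    {M : L.code.MWChoices} {D : L.pi.DKKChoices} (h : L.Corresponding o ℓ M D)
    {c : L.Crossing} {s t : L.Crossing → Bool} (hst : ∀ c', c' ≠ c → s c' = t c')
    (v : Circle (N := L.code) s → Bool) (w : Circle (N := L.code) t → Bool) :
    edgeCoeff (N := L.pi) D.num s t (firstSite ℓ c) (secondSite ℓ c)
        (fun y => cutsAlong o ℓ s (start o ℓ s (D.base s (circleAt s y))) y)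
        (fun y => cutsAlong o ℓ t (depart o ℓ t (D.base t (circleAt t y)) y)
          (D.base t (circleAt t y)))
        (fun a => cutsAlong o ℓ s (start o ℓ s (D.base s a)) (D.base t (carry t a)))
        (fun a => v ((L.piCircle s).symm a)) (fun a => w ((L.piCircle t).symm a)) =
      edgeCoeff (N := L.code) M.num s t (firstSite ℓ c) (secondSite ℓ c)
        (nearbyMismatch (N := L.code) ℓ (M.orient s)) (nearbyMismatch (N := L.code) ℓ (M.orient t))
        (farMismatch M s t) v w := by
  have horient : ∀ u : L.Crossing → Bool,
      OrientsCircles (N := L.pi) u (L.piOrient (M.orient u)) := fun u =>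
    L.orientsCircles_piOrient ⟨M.orient_arc u, M.orient_joint u⟩
  have hbase : ∀ (u : L.Crossing → Bool) (a : Circle (N := L.pi) u),
      localSgn o ℓ (L.piOrient (M.orient u)) (D.base u a) = 1 := fun u a =>
    localSgn_eq_one (h.orient u a)
  have hstart : ∀ (u : L.Crossing → Bool) (a : Circle (N := L.pi) u),
      circleAt (N := L.pi) u (start o ℓ u (D.base u a)) = a := fun u a =>
    (circleAt_start o ℓ u _).trans (D.base_mem u a)
  have hnear : ∀ (u : L.Crossing → Bool) (i : Fin 4),
      localSgn o ℓ (L.piOrient (M.orient u)) (Sum.inl (c, i)) =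
        (-1) ^ nearbyMismatch (N := L.code) ℓ (M.orient u) (Sum.inl (c, i)) := fun u i =>
    (neg_one_pow_nearbyMismatch o ℓ (L.piOrient (M.orient u)) c i).symm
  refine L.edgeCoeff_pi h.num ℓ hst (fun i => ?_) (fun i => ?_) (fun a ha => ?_) v w
  · dsimp only
    rw [neg_one_pow_cutsAlong o ℓ (horient s) (hstart s _), localSgn_start o ℓ (horient s),
      hbase, one_mul, hnear]
  · dsimp only
    rw [neg_one_pow_cutsAlong o ℓ (horient t)
      ((circleAt_depart o ℓ t _ _).trans (D.base_mem t _).symm),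
      localSgn_depart o ℓ (horient t), hbase, mul_one, hnear]
  · -- The local orientation at the new base point is the orientation after the bifurcation, so
    -- the cut points between the base points compare the orientations before and after.
    have hz : circleAt (N := L.pi) s (Quot.out (L.piCircle s a)) = L.piCircle s a :=
      circleAt_out _
    have hoff : OffSite (N := L.pi) ℓ c (circleAt s (Quot.out (L.piCircle s a))) :=
      hz.symm ▸ L.offSite_piCircle.mpr ha
    have hb : circleAt (N := L.pi) s (D.base t (carry t (L.piCircle s a))) = L.piCircle s a := by
      refine Eq.trans ?_ hz
      exact (circleAt_eq_of_offSite (N := L.pi) (fun c' hc => (hst c' hc).symm)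
        (OffSite.circleAt hst hoff) (D.base_mem t (carry t (L.piCircle s a))).symm).symm
    have hout : circleAt (N := L.pi) s (L.inside (Quot.out a)) = L.piCircle s a :=
      congrArg (L.piCircle s) (circleAt_out (N := L.code) a)
    rw [neg_one_pow_cutsAlong o ℓ (horient s) ((hstart s _).trans hb.symm),
      localSgn_start o ℓ (horient s), hbase, one_mul, localSgn, ← h.orient t, mul_comm,
      boolSgn_mul_eq_of_offSite hst (horient s) (horient t)
        (hb.symm ▸ L.offSite_piCircle.mpr ha) (hb.trans hout.symm), piOrient_inside, piOrient_inside,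
      farMismatch, neg_one_pow_mismatch]

/-! ### The isomorphism of complexes -/

variable (L)

/-- The bijection of labelled states underlying `α`. -/
def piEnhancedEquiv (i : ℕ) : L.code.Enhanced i ≃ L.pi.Enhanced i where
  toFun := L.piEnhanced i
  invFun e := ⟨⟨e.1.1, fun a => e.1.2 (L.piCircle e.1.1 a)⟩, e.2⟩
  left_inv e := by
    refine Subtype.ext (Sigma.ext rfl (heq_of_eq (funext fun a => ?_)))
    exact congrArg e.1.2 ((L.piCircle e.1.1).symm_apply_apply a)
  right_inv e := by
    refine Subtype.ext (Sigma.ext rfl (heq_of_eq (funext fun a => ?_)))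
    exact congrArg e.1.2 ((L.piCircle e.1.1).apply_symm_apply a)

theorem alpha_bijective (i : ℕ) : Function.Bijective (L.alpha i) :=
  ⟨Finsupp.mapDomain_injective (L.piEnhancedEquiv i).injective,
    Finsupp.mapDomain_surjective (L.piEnhancedEquiv i).surjective⟩

variable {L}

theorem alpha_comp_mwDifferential {o : L.pi.LinkOrientation} {ℓ : L.Crossing → Fin 4}
    {M : L.code.MWChoices} {D : L.pi.DKKChoices} (h : L.Corresponding o ℓ M D) (i : ℕ) :
    L.alpha (i + 1) ∘ₗ mwDifferential (N := L.code) ℓ M i =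
      dkkDifferential (N := L.pi) o ℓ D i ∘ₗ L.alpha i := by
  refine Finsupp.lhom_ext' fun e => LinearMap.ext_ring (Finsupp.ext fun e' => ?_)
  obtain ⟨e', rfl⟩ := (L.piEnhancedEquiv (i + 1)).surjective e'
  have hα : L.alpha i (Finsupp.single e 1) = Finsupp.single (L.piEnhanced i e) 1 :=
    Finsupp.mapDomain_single
  have hα' : ∀ x, L.alpha (i + 1) x (L.piEnhancedEquiv (i + 1) e') = x e' := fun x =>
    Finsupp.mapDomain_apply (L.piEnhancedEquiv (i + 1)).injective x e'
  simp only [LinearMap.comp_apply, Finsupp.lsingle_apply, hα, hα', mwDifferential,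
    dkkDifferential, cubeDifferential, Finsupp.linearCombination_single, one_smul]
  refine Finset.sum_congr rfl fun c _ => ?_
  refine if_ctx_congr Iff.rfl (fun hc => ?_) fun _ => rfl
  refine (edgeCoeff_of_corresponding h (fun c' hc' => ?_) e.1.2 e'.1.2).symm
  exact ((congrFun hc.2 c').trans (Function.update_of_ne hc' _ _)).symm

end ProjectiveLinkDiagram

namespace LinkCode

/-- An isomorphism of complexes induces isomorphisms in cohomology. -/
theorem exists_cohomology_equiv {N N' : LinkCode}
    {d : ∀ i, N.Cochain i →ₗ[ℚ] N.Cochain (i + 1)}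
    {d' : ∀ i, N'.Cochain i →ₗ[ℚ] N'.Cochain (i + 1)}
    (α : ∀ i, N.Cochain i ≃ₗ[ℚ] N'.Cochain i) (h : ∀ i x, α (i + 1) (d i x) = d' i (α i x))
    (i : ℕ) :
    ∃ φ : Cohomology d i ≃ₗ[ℚ] Cohomology d' i, ∀ z : LinearMap.ker (d i),
      ∃ hz : α i z ∈ LinearMap.ker (d' i),
        φ (Submodule.Quotient.mk z) = Submodule.Quotient.mk ⟨α i z, hz⟩ := by
  have hmem : ∀ x, α i x ∈ LinearMap.ker (d' i) ↔ x ∈ LinearMap.ker (d i) := fun x => by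
    rw [LinearMap.mem_ker, LinearMap.mem_ker, ← h, LinearEquiv.map_eq_zero_iff]
  have hcob : ∀ (i : ℕ) (x), α i x ∈ coboundaries d' i ↔ x ∈ coboundaries d i := by
    rintro (_ | i) x
    · exact (α 0).map_eq_zero_iff
    · constructor
      · rintro ⟨y, hy⟩
        obtain ⟨y, rfl⟩ := (α i).surjective y
        rw [← h] at hy
        exact ⟨y, (α (i + 1)).injective hy⟩
      · rintro ⟨y, rfl⟩
        exact ⟨α i y, (h i y).symm⟩
  have hker : (LinearMap.ker (d i)).map (α i : N.Cochain i →ₗ[ℚ] N'.Cochain i) =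
      LinearMap.ker (d' i) := by
    ext y
    obtain ⟨x, rfl⟩ := (α i).surjective y
    rw [hmem]
    exact (α i).injective.mem_set_image
  let e := (α i).ofSubmodules _ _ hker
  have he : ((coboundaries d i).submoduleOf (LinearMap.ker (d i))).map
      (e : LinearMap.ker (d i) →ₗ[ℚ] LinearMap.ker (d' i)) =
      (coboundaries d' i).submoduleOf (LinearMap.ker (d' i)) := by
    ext y
    obtain ⟨x, rfl⟩ := e.surjective y
    exact e.injective.mem_set_image.trans (hcob i x).symm
  exact ⟨Submodule.Quotient.equiv _ _ e he, fun z => ⟨(hmem z).mpr z.2, rfl⟩⟩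

end LinkCode

open LinkCode in
theorem mainTheorem2 (L : ProjectiveLinkDiagram) (o : L.pi.LinkOrientation)
    (ℓ : L.Crossing → Fin 4) (D : L.pi.DKKChoices) :
    (∃ M : L.code.MWChoices, L.Corresponding o ℓ M D) ∧
    ∀ M : L.code.MWChoices, L.Corresponding o ℓ M D →
      (∀ i, Function.Bijective (L.alpha i)) ∧
      (∀ i, L.alpha (i + 1) ∘ₗ mwDifferential (N := L.code) ℓ M i =
        dkkDifferential (N := L.pi) o ℓ D i ∘ₗ L.alpha i) ∧
      ∀ i, ∃ φ : Cohomology (mwDifferential (N := L.code) ℓ M) i ≃ₗ[ℚ]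
          Cohomology (dkkDifferential (N := L.pi) o ℓ D) i,
        ∀ z : LinearMap.ker (mwDifferential (N := L.code) ℓ M i),
          ∃ hz : L.alpha i z ∈ LinearMap.ker (dkkDifferential (N := L.pi) o ℓ D i),
            φ (Submodule.Quotient.mk z) = Submodule.Quotient.mk ⟨L.alpha i z, hz⟩ :=
  ⟨L.exists_corresponding o ℓ D, fun _ h =>
    ⟨L.alpha_bijective, ProjectiveLinkDiagram.alpha_comp_mwDifferential h,
      exists_cohomology_equiv (fun i => LinearEquiv.ofBijective (L.alpha i) (L.alpha_bijective i))
        fun i => LinearMap.congr_fun (ProjectiveLinkDiagram.alpha_comp_mwDifferential h i)⟩⟩
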